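/- Let $\mathfrak g$ be a finite-dimensional real Lie algebra that is solvable and unimodular ($\operatorname{tr}\operatorname{ad}_x=0$ for all $x\in\mathfrak g$). Let $(J,\langle\cdot,\cdot\rangle)$ be a Hermitian structure on $\mathfrak g$: $\langle\cdot,\cdot\rangle$ is an inner product and $J:\mathfrak g\to\mathfrak g$ is a skew-symmetric endomorphism with $J^2=-I$ and $[Jx,Jy]-[x,y]-J([Jx,y]+[x,Jy])=0$ for all $x,y$. Put $\omega(x,y)=\langle Jx,y\rangle$ and $d\omega(x,y,z)=-\omega([x,y],z)-\omega([y,z],x)-\omega([z,x],y)$, and let $\nabla^g:\mathfrak g\times\mathfrak g\to\mathfrak g$ be the Levi-Civita connection, $2\langle\nabla^g_xy,z\rangle=\langle[x,y],z\rangle-\langle[y,z],x\rangle+\langle[z,x],y\rangle$. Assume that the structure is Vaisman: there is a $1$-form $\theta\in\mathfrak g^*$ (the Lee form) with $\theta([x,y])=0$ for all $x,y$, with $d\omega=\theta\wedge\omega$, i.e. $d\omega(x,y,z)=\theta(x)\omega(y,z)+\theta(y)\omega(z,x)+\theta(z)\omega(x,y)$, and with $\nabla^g\theta=0$. Let $A\in\mathfrak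 g$ be the metric dual of $\theta$, $\langle A,u\rangle=\theta(u)$, and assume the normalization $|A|=1$. Let $\nabla^b$ be the Bismut connection, $$\langle\nabla^b_xy,z\rangle=\langle\nabla^g_xy,z\rangle+\tfrac12\,d\omega(Jx,Jy,Jz),$$ let $R^b(u,v)=\nabla^b_u\nabla^b_v-\nabla^b_v\nabla^b_u-\nabla^b_{[u,v]}$ be its curvature, and let $\varphi=J-\theta\otimes JA+J\theta\otimes A$, where $J\theta(x)=-\theta(Jx)$. Then $$R^b(u,v)=\langle\varphi u,v\rangle\,\varphi\qquad\text{for all }u,v\in\mathfrak g,$$ and $R^b$ is $\nabla^b$-parallel: for all $x,y,z,w\in\mathfrak g$, $$(\nabla^b_xR^b)(y,z)w:=\nabla^b_x(R^b(y,z)w)-R^b(\nabla^b_xy,z)w-R^b(y,\nabla^b_xz)w-R^b(y,z)(\nabla^b_xw)=0.$$ -/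

import Mathlib

noncomputable section

namespace VaismanLie

variable {𝔤 : Type*} [LieRing 𝔤] [LieAlgebra ℝ 𝔤]

/-- A Lie algebra is unimodular if `tr (ad x) = 0` for every `x`. -/
def IsUnimodular (𝔤 : Type*) [LieRing 𝔤] [LieAlgebra ℝ 𝔤] : Prop :=
  ∀ x : 𝔤, LinearMap.trace ℝ 𝔤 (LieAlgebra.ad ℝ 𝔤 x) = 0

/-- A Hermitian structure on a real Lie algebra: an inner product `g` together with a
`g`-skew-symmetric endomorphism `J` with `J² = -1` and vanishing Nijenhuis tensor. -/
structure HermitianStructure (𝔤 : Type*) [LieRing 𝔤] [LieAlgebra ℝ 𝔤] where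
  /-- the inner product -/
  g : LinearMap.BilinForm ℝ 𝔤
  /-- the complex structure -/
  J : 𝔤 →ₗ[ℝ] 𝔤
  symm : ∀ x y, g x y = g y x
  pos : ∀ x, x ≠ 0 → 0 < g x x
  J_sq : ∀ x, J (J x) = -x
  J_skew : ∀ x y, g (J x) y = -g x (J y)
  integrable : ∀ x y, ⁅J x, J y⁆ - ⁅x, y⁆ - J (⁅J x, y⁆ + ⁅x, J y⁆) = 0

namespace HermitianStructure

variable (h : HermitianStructure 𝔤)

theorem nondegenerate : h.g.Nondegenerate := by
  refine ⟨fun x hx => ?_, fun x hx => ?_⟩ <;>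
  · by_contra hne
    exact absurd (hx x) (h.pos x hne).ne'

/-- The fundamental 2-form `ω(x, y) = g(Jx, y)`. -/
def omega (x y : 𝔤) : ℝ := h.g (h.J x) y

/-- The Chevalley–Eilenberg differential of the fundamental 2-form,
`dω(x, y, z) = -ω([x, y], z) - ω([y, z], x) - ω([z, x], y)`. -/
def dOmega (x y z : 𝔤) : ℝ :=
  -h.omega ⁅x, y⁆ z - h.omega ⁅y, z⁆ x - h.omega ⁅z, x⁆ y

/-- The right-hand side of the Koszul formula for left invariant fields:
`½ (g([x, y], z) - g([y, z], x) + g([z, x], y))`, as a linear form in `z`. -/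
def koszulForm : 𝔤 →ₗ[ℝ] 𝔤 →ₗ[ℝ] Module.Dual ℝ 𝔤 :=
  LinearMap.mk₂ ℝ
    (fun x y =>
      { toFun := fun z => (1 / 2 : ℝ) * (h.g ⁅x, y⁆ z - h.g ⁅y, z⁆ x + h.g ⁅z, x⁆ y)
        map_add' := by intro a b; simp; ring
        map_smul' := by intro r a; simp; ring })
    (by intro a b c; ext z; simp; ring)
    (by intro r a b; ext z; simp; ring)
    (by intro a b c; ext z; simp; ring)
    (by intro r a b; ext z; simp; ring)

/-- The term `½ dω(Jx, Jy, Jz)`, as a linear form in `z`. -/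
def torsionForm : 𝔤 →ₗ[ℝ] 𝔤 →ₗ[ℝ] Module.Dual ℝ 𝔤 :=
  LinearMap.mk₂ ℝ
    (fun x y =>
      { toFun := fun z => (1 / 2 : ℝ) * h.dOmega (h.J x) (h.J y) (h.J z)
        map_add' := by intro a b; simp [dOmega, omega]; ring
        map_smul' := by intro r a; simp [dOmega, omega]; ring })
    (by intro a b c; ext z; simp [dOmega, omega]; ring)
    (by intro r a b; ext z; simp [dOmega, omega]; ring)
    (by intro a b c; ext z; simp [dOmega, omega]; ring)
    (by intro r a b; ext z; simp [dOmega, omega]; ring)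

section Connections

variable [FiniteDimensional ℝ 𝔤]

/-- Raise the last index with the inner product: `g (raise F x y) z = F x y z`. -/
def raise (F : 𝔤 →ₗ[ℝ] 𝔤 →ₗ[ℝ] Module.Dual ℝ 𝔤) : 𝔤 →ₗ[ℝ] 𝔤 →ₗ[ℝ] 𝔤 :=
  F.compr₂ (h.g.toDual h.nondegenerate).symm.toLinearMap

theorem g_raise (F : 𝔤 →ₗ[ℝ] 𝔤 →ₗ[ℝ] Module.Dual ℝ 𝔤) (x y z : 𝔤) :
    h.g (h.raise F x y) z = F x y z := by
  simp [raise, LinearMap.BilinForm.apply_toDual_symm_apply]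

/-- The Levi-Civita connection of the left invariant metric, as a bilinear product
`(x, y) ↦ ∇ᵍₓ y` on the Lie algebra. -/
def leviCivita : 𝔤 →ₗ[ℝ] 𝔤 →ₗ[ℝ] 𝔤 := h.raise h.koszulForm

/-- The Bismut connection `g(∇ᵇₓ y, z) = g(∇ᵍₓ y, z) + ½ dω(Jx, Jy, Jz)`. -/
def bismut : 𝔤 →ₗ[ℝ] 𝔤 →ₗ[ℝ] 𝔤 := h.leviCivita + h.raise h.torsionForm

theorem g_leviCivita (x y z : 𝔤) :
    h.g (h.leviCivita x y) z
      = (1 / 2 : ℝ) * (h.g ⁅x, y⁆ z - h.g ⁅y, z⁆ x + h.g ⁅z, x⁆ y) :=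
  h.g_raise _ x y z

theorem g_bismut (x y z : 𝔤) :
    h.g (h.bismut x y) z
      = h.g (h.leviCivita x y) z + (1 / 2 : ℝ) * h.dOmega (h.J x) (h.J y) (h.J z) := by
  have := h.g_raise h.torsionForm x y z
  simp only [bismut, LinearMap.add_apply, map_add, this]
  rfl

end Connections

end HermitianStructure

/-- The curvature `R(x, y) = ∇ₓ∇_y - ∇_y∇ₓ - ∇_[x, y]` of a left invariant connection. -/
def curvature (nabla : 𝔤 →ₗ[ℝ] 𝔤 →ₗ[ℝ] 𝔤) (x y : 𝔤) : 𝔤 →ₗ[ℝ] 𝔤 :=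
  nabla x ∘ₗ nabla y - nabla y ∘ₗ nabla x - nabla ⁅x, y⁆

/-- The covariant derivative of a left invariant `(1,3)`-tensor `R`:
`(∇ₓR)(y, z)w = ∇ₓ(R(y, z)w) - R(∇ₓy, z)w - R(y, ∇ₓz)w - R(y, z)(∇ₓw)`. -/
def covDeriv (nabla : 𝔤 →ₗ[ℝ] 𝔤 →ₗ[ℝ] 𝔤) (R : 𝔤 → 𝔤 → 𝔤 →ₗ[ℝ] 𝔤) (x y z w : 𝔤) : 𝔤 :=
  nabla x (R y z w) - R (nabla x y) z w - R y (nabla x z) w - R y z (nabla x w)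

/-- A Vaisman structure: a Hermitian structure with a 1-form `θ` (the Lee form) that is closed,
satisfies `dω = θ ∧ ω`, and is parallel for the Levi-Civita connection. -/
structure VaismanStructure (𝔤 : Type*) [LieRing 𝔤] [LieAlgebra ℝ 𝔤]
    [FiniteDimensional ℝ 𝔤] extends HermitianStructure 𝔤 where
  /-- the Lee form -/
  θ : Module.Dual ℝ 𝔤
  closed : ∀ x y : 𝔤, θ ⁅x, y⁆ = 0
  lck : ∀ x y z, toHermitianStructure.dOmega x y z
    = θ x * toHermitianStructure.omega y z + θ y * toHermitianStructure.omega z x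
      + θ z * toHermitianStructure.omega x y
  /-- `∇ᵍθ = 0`, since `(∇ᵍₓθ)(y) = -θ(∇ᵍₓ y)` for left invariant fields -/
  parallel : ∀ x y, θ (toHermitianStructure.leviCivita x y) = 0

namespace VaismanStructure

variable [FiniteDimensional ℝ 𝔤] (V : VaismanStructure 𝔤)

/-- The metric dual `A` of the Lee form. -/
def A : 𝔤 := (V.g.toDual V.nondegenerate).symm V.θ

theorem g_A (u : 𝔤) : V.g V.A u = V.θ u := by
  simp [A, LinearMap.BilinForm.apply_toDual_symm_apply]

/-- The tensor `φ = J - θ ⊗ JA + Jθ ⊗ A`, where `(Jθ)(x) = -θ(Jx)`. -/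
def phi : 𝔤 →ₗ[ℝ] 𝔤 :=
  V.J - V.θ.smulRight (V.J V.A) + (-(V.θ ∘ₗ V.J)).smulRight V.A

end VaismanStructure

end VaismanLie

end

/-!
Write `ξ = JA` and `η = ⟨ξ, ·⟩`. The idea is that, once `ξ` is known to be central, splitting it off
leaves a flat Kähler Lie algebra, and the Bismut connection is the flat connection of that algebra
corrected by a rank-one term in the direction `ξ`.

*`ξ` is central* (`VaismanStructure.lie_xi_eq_zero`). Both `A` and `ξ` are Killing and holomorphic,
and `η([x, y]) = ⟨φx, y⟩` (`VaismanStructure.eta_lie`). Contracting `dω = θ ∧ ω` with `J` and using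
unimodularity gives `∑ [eᵢ, Jeᵢ] = (dim 𝔤 - 2) ξ` for an orthonormal basis
(`HermitianStructure.omega_sum_lie_J`), so outside dimension two `ξ` lies in the derived algebra.
By Lie's theorem `ad ξ` is then nilpotent; being skew-symmetric, it vanishes.

*Splitting off `ξ`* (`VaismanStructure.Transverse`). The bracket `[x, y] - η([x, y]) ξ` on the same
vector space is again a unimodular Lie bracket satisfying `tr (ad x)² = 0` on the derived
algebra, and with the same metric and complex structure it is Kähler.

*Flatness* (`HermitianStructure.curvature_eq_zero_of_kaehler`). In a unimodular Kähler Lie algebra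
the vector `∑ [eᵢ, Jeᵢ]` vanishes. Since `tr (J R(x, y)) = -tr (J ∇_[x, y])`, the Bianchi identity
shows that the scalar curvature is zero (`HermitianStructure.scalarCurvature_eq_zero`). On the other
hand the scalar curvature of a unimodular metric Lie algebra is
`-½ ∑ tr (ad eᵢ)² - ¼ ∑ |[eᵢ, eⱼ]|²`, and as the Killing form vanishes on the diagonal of the derived algebra, this is minus a sum of
squares (an argument of Milnor, `structure_constants_of_sum_eq_zero`). All squares are therefore
zero: the derived algebra and its orthogonal complement are abelian, and the latter acts by
skew-symmetric operators. Such a metric Lie algebra is flat.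

*Conclusion.* If `D` denotes the flat connection, then `∇ᵇₓ y = Dₓ y - η(x) φy`
(`VaismanStructure.Transverse.bismut_eq`), and `D` commutes with `φ` and vanishes along
`ξ`. Hence `Rᵇ(u, v) = η([u, v]) φ = ⟨φu, v⟩ φ`, which is parallel because `∇ᵇ` is metric
and commutes with `φ`.
-/

/-! ### Nilpotency of the derived algebra of a solvable Lie algebra -/

open scoped TensorProduct

/-- Over an algebraically closed field, elements of the derived algebra of a solvable Lie algebra
act nilpotently on every finite-dimensional module: by Lie's theorem some weight space is nonzero,
the derived algebra kills it, and one passes to the quotient. -/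
theorem LieModule.isNilpotent_toEnd_of_mem_derivedSeries {k L : Type*} [Field k] [CharZero k]
    [IsAlgClosed k] [LieRing L] [LieAlgebra k L] [LieAlgebra.IsSolvable L]
    {x : L} (hx : x ∈ LieAlgebra.derivedSeries k L 1) (V : Type*) [AddCommGroup V]
    [Module k V] [LieRingModule L V] [LieModule k L V] [FiniteDimensional k V] :
    _root_.IsNilpotent (LieModule.toEnd k L V x) := by
  induction hn : Module.finrank k V using Nat.strong_induction_on generalizing V with
  | _ n ih =>
  rcases subsingleton_or_nontrivial V with hV | hV
  · exact ⟨1, LinearMap.ext fun v => Subsingleton.elim _ _⟩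
  obtain ⟨χ, hχ⟩ := LieModule.exists_nontrivial_weightSpace_of_isSolvable k L V
  set W := LieModule.weightSpace V χ
  have hW (y : L) (v : V) (hv : v ∈ W) : ⁅y, v⁆ = χ y • v :=
    (LieModule.mem_weightSpace (χ := χ) (m := v)).1 hv y
  obtain ⟨⟨w, hw⟩, hw0⟩ := exists_ne (0 : W)
  have hw0' : w ≠ 0 := fun h => hw0 (Subtype.ext h)
  have hχx : χ x = 0 := by
    have hbr (y z : L) : χ ⁅y, z⁆ = 0 := by
      have h1 := hW ⁅y, z⁆ w hw
      rw [lie_lie, hW z w hw, lie_smul, hW y w hw, lie_smul, hW z w hw, smul_comm, sub_self] at h1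
      exact (smul_eq_zero.1 h1.symm).resolve_right hw0'
    have hx' : x ∈ (LieAlgebra.derivedSeries k L 1 : LieSubalgebra k L).toSubmodule := hx
    rw [LieAlgebra.coe_derivedSeries_one_eq] at hx'
    refine Submodule.span_le (p := LinearMap.ker χ).2 ?_ hx'
    rintro _ ⟨a, b, rfl⟩
    exact hbr a b
  -- `x` kills `W` and is nilpotent on the smaller module `V ⧸ W`
  have hlt : Module.finrank k (V ⧸ W) < n := by
    have h1 := W.toSubmodule.finrank_quotient_add_finrank
    have h2 : 0 < Module.finrank k W := Module.finrank_pos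
    have h3 : Module.finrank k (V ⧸ W) = Module.finrank k (V ⧸ W.toSubmodule) := rfl
    have h4 : Module.finrank k W = Module.finrank k W.toSubmodule := rfl
    omega
  obtain ⟨m, hm⟩ := ih _ hlt (V ⧸ W) rfl
  refine ⟨m + 1, LinearMap.ext fun v => ?_⟩
  have hmk (j : ℕ) (v : V) : (LieModule.toEnd k L (V ⧸ W) x ^ j) (LieSubmodule.Quotient.mk v)
      = LieSubmodule.Quotient.mk ((LieModule.toEnd k L V x ^ j) v) := by
    induction j with
    | zero => rfl
    | succ j ihj => rw [pow_succ', pow_succ', Module.End.mul_apply, ihj]; rfl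
  have hmem : (LieModule.toEnd k L V x ^ m) v ∈ W := by
    rw [← LieSubmodule.Quotient.mk_eq_zero', ← hmk, hm]; rfl
  rw [pow_succ', Module.End.mul_apply, LieModule.toEnd_apply_apply, hW _ _ hmem, hχx, zero_smul]
  rfl

/-- The half of Cartan's criterion used below: in a solvable Lie algebra over a field of
characteristic zero, `tr (ad x)² = 0` for `x` in the derived algebra. -/
theorem LieAlgebra.trace_ad_comp_ad_eq_zero_of_isSolvable {K L : Type*} [Field K] [CharZero K]
    [LieRing L] [LieAlgebra K L] [FiniteDimensional K L] [LieAlgebra.IsSolvable L] {x : L}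
    (hx : x ∈ Submodule.span K {m : L | ∃ y z : L, ⁅y, z⁆ = m}) :
    LinearMap.trace K L (LieAlgebra.ad K L x ∘ₗ LieAlgebra.ad K L x) = 0 := by
  let F := AlgebraicClosure K
  have hx' : x ∈ LieAlgebra.derivedSeries K L 1 := by
    change x ∈ (LieAlgebra.derivedSeries K L 1 : LieSubalgebra K L).toSubmodule
    rw [LieAlgebra.coe_derivedSeries_one_eq]
    exact hx
  have hmem : (1 : F) ⊗ₜ[K] x ∈ LieAlgebra.derivedSeries F (F ⊗[K] L) 1 := by
    rw [LieAlgebra.derivedSeries_baseChange]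
    exact Submodule.tmul_mem_baseChange_of_mem 1 hx'
  have hnil := LieModule.isNilpotent_toEnd_of_mem_derivedSeries hmem (F ⊗[K] L)
  rw [LieModule.toEnd_baseChange] at hnil
  have hinj : Function.Injective (Module.End.baseChangeHom K F L) :=
    LinearMap.baseChangeHom_injective K L F
  have hadnil : IsNilpotent (LieAlgebra.ad K L x) := (IsNilpotent.map_iff hinj).1 hnil
  have hsq : IsNilpotent (LieAlgebra.ad K L x ∘ₗ LieAlgebra.ad K L x) :=
    (Commute.refl (LieAlgebra.ad K L x)).isNilpotent_mul_left hadnil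
  exact (LinearMap.isNilpotent_trace_of_isNilpotent hsq).eq_zero

/-! ### Orthonormal bases of positive definite bilinear forms -/

namespace LinearMap.BilinForm

variable {V ι : Type*} [AddCommGroup V] [Module ℝ V] [Fintype ι] [DecidableEq ι]

/-- A family is orthonormal for the bilinear form `g`. -/
def IsOrthonormal (g : LinearMap.BilinForm ℝ V) (e : ι → V) : Prop :=
  ∀ i j, g (e i) (e j) = if i = j then 1 else 0

theorem exists_isOrthonormal_basis [FiniteDimensional ℝ V] (g : LinearMap.BilinForm ℝ V)
    (hs : ∀ x y, g x y = g y x) (hp : ∀ x, x ≠ 0 → 0 < g x x) :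
    ∃ e : Module.Basis (Fin (Module.finrank ℝ V)) ℝ V, g.IsOrthonormal e := by
  obtain ⟨v, hv⟩ := LinearMap.BilinForm.exists_orthogonal_basis (B := g) ⟨hs⟩
  have hpos (i) : 0 < g (v i) (v i) := hp _ (v.ne_zero i)
  have hu (i) : IsUnit ((Real.sqrt (g (v i) (v i)))⁻¹) :=
    (inv_ne_zero (Real.sqrt_ne_zero'.2 (hpos i))).isUnit
  refine ⟨v.isUnitSMul hu, fun i j => ?_⟩
  rw [Module.Basis.isUnitSMul_apply, Module.Basis.isUnitSMul_apply]
  split_ifs with h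
  · subst h
    have h1 := Real.mul_self_sqrt (hpos i).le
    have h2 := Real.sqrt_ne_zero'.2 (hpos i)
    simp only [map_smul, LinearMap.smul_apply, smul_eq_mul]
    rw [← mul_assoc, ← mul_inv, h1, inv_mul_cancel₀ (hpos i).ne']
  · have : g (v i) (v j) = 0 := hv h
    simp [this]

variable {g : LinearMap.BilinForm ℝ V} {e : Module.Basis ι ℝ V}

namespace IsOrthonormal

theorem repr_apply (he : g.IsOrthonormal e) (x : V) (i : ι) : e.repr x i = g x (e i) := by
  conv_rhs => rw [← e.sum_repr x]
  simp [-Module.Basis.sum_repr, he _ i]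

theorem sum_smul (he : g.IsOrthonormal e) (x : V) : ∑ i, g x (e i) • e i = x := by
  simp_rw [← he.repr_apply]
  exact e.sum_repr x

theorem sum_mul (he : g.IsOrthonormal e) (x y : V) : ∑ i, g x (e i) * g (e i) y = g x y := by
  conv_rhs => rw [← he.sum_smul x]
  simp

theorem trace_eq_sum (he : g.IsOrthonormal e) (T : V →ₗ[ℝ] V) :
    LinearMap.trace ℝ V T = ∑ i, g (T (e i)) (e i) := by
  rw [LinearMap.trace_eq_matrix_trace ℝ e]
  simp [Matrix.trace, LinearMap.toMatrix_apply, he.repr_apply]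

theorem ext (he : g.IsOrthonormal e) {x y : V} (h : ∀ i, g x (e i) = g y (e i)) : x = y := by
  rw [← he.sum_smul x, ← he.sum_smul y]
  simp [h]

/-- The contraction of a bilinear map does not depend on the orthonormal basis. -/
theorem sum_apply_self_eq {κ W : Type*} [Fintype κ] [DecidableEq κ] [AddCommGroup W] [Module ℝ W]
    (hs : ∀ x y, g x y = g y x) (he : g.IsOrthonormal e) {f : Module.Basis κ ℝ V}
    (hf : g.IsOrthonormal f) (F : V →ₗ[ℝ] V →ₗ[ℝ] W) :
    ∑ i, F (f i) (f i) = ∑ i, F (e i) (e i) := by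
  have h1 (i : κ) : F (f i) (f i)
      = ∑ j, ∑ k, (g (e j) (f i) * g (f i) (e k)) • F (e j) (e k) := by
    conv_lhs => rw [← he.sum_smul (f i)]
    simp only [map_sum, map_smul, LinearMap.sum_apply, LinearMap.smul_apply, Finset.smul_sum,
      smul_smul]
    rw [Finset.sum_comm]
    refine Finset.sum_congr rfl fun j _ => Finset.sum_congr rfl fun k _ => ?_
    rw [hs (f i) (e j), mul_comm]
  simp_rw [h1]
  rw [Finset.sum_comm]
  refine Finset.sum_congr rfl fun j _ => ?_
  rw [Finset.sum_comm]
  simp_rw [← Finset.sum_smul, hf.sum_mul, he j]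
  simp

end IsOrthonormal

/-- For a positive definite form, every subspace `W` is spanned by a part of an orthonormal basis
whose remaining members are orthogonal to `W`. -/
theorem exists_isOrthonormal_basis_adapted [FiniteDimensional ℝ V] (g : LinearMap.BilinForm ℝ V)
    (hs : ∀ x y, g x y = g y x) (hp : ∀ x, x ≠ 0 → 0 < g x x) (W : Submodule ℝ V) :
    ∃ (m n : ℕ) (e : Module.Basis (Fin m ⊕ Fin n) ℝ V), g.IsOrthonormal e ∧
      (∀ i, ∀ w ∈ W, g w (e (Sum.inl i)) = 0) ∧ ∀ j, e (Sum.inr j) ∈ W := by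
  have hdis : IsCompl (g.orthogonal W) W := by
    refine (LinearMap.BilinForm.isCompl_orthogonal_of_restrict_nondegenerate (B := g)
      (fun x y h => by rw [hs]; exact h) ?_).symm
    refine ⟨fun x hx => ?_, fun x hx => ?_⟩ <;>
    · by_contra hne
      exact (hp x (fun h => hne (Subtype.ext h))).ne' (hx x)
  obtain ⟨a, ha⟩ := exists_isOrthonormal_basis (g.restrict (g.orthogonal W))
    (fun x y => hs x y) (fun x hx => hp x (fun h => hx (Subtype.ext h)))
  obtain ⟨b, hb⟩ := exists_isOrthonormal_basis (g.restrict W)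
    (fun x y => hs x y) (fun x hx => hp x (fun h => hx (Subtype.ext h)))
  have hort (i j) : g (b j : V) (a i : V) = 0 := (a i).2 _ (b j).2
  refine ⟨_, _, (a.prod b).map (Submodule.prodEquivOfIsCompl _ _ hdis), ?_, ?_, ?_⟩
  · rintro (i | i) (j | j)
    · simpa using ha i j
    · simpa [hs (a i : V)] using hort i j
    · simpa using hort j i
    · simpa using hb i j
  · intro i w hw
    simpa using (a i).2 w hw
  · intro j
    simp

end LinearMap.BilinForm

/-! ### Hermitian Lie algebras and their Levi-Civita connection -/

noncomputable section

namespace VaismanLie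

variable {𝔤 : Type*} [LieRing 𝔤] [LieAlgebra ℝ 𝔤]

/-- The curvature of a left invariant connection as a bilinear map with values in
endomorphisms. -/
def curvatureBilin (nabla : 𝔤 →ₗ[ℝ] 𝔤 →ₗ[ℝ] 𝔤) : 𝔤 →ₗ[ℝ] 𝔤 →ₗ[ℝ] 𝔤 →ₗ[ℝ] 𝔤 :=
  LinearMap.mk₂ ℝ (curvature nabla)
    (by intro a b c; ext z; simp [curvature]; abel)
    (by intro r a b; ext z; simp [curvature, smul_sub])
    (by intro a b c; ext z; simp [curvature]; abel)
    (by intro r a b; ext z; simp [curvature, smul_sub])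

theorem curvatureBilin_apply (nabla : 𝔤 →ₗ[ℝ] 𝔤 →ₗ[ℝ] 𝔤) (x y : 𝔤) :
    curvatureBilin nabla x y = curvature nabla x y := rfl

theorem curvature_swap (nabla : 𝔤 →ₗ[ℝ] 𝔤 →ₗ[ℝ] 𝔤) (x y : 𝔤) :
    curvature nabla x y = -curvature nabla y x := by
  ext z
  simp only [curvature, LinearMap.sub_apply, LinearMap.comp_apply, LinearMap.neg_apply]
  rw [← lie_skew x y, map_neg, LinearMap.neg_apply]
  abel

/-- The first Bianchi identity for a torsion-free connection. -/
theorem curvature_bianchi (nabla : 𝔤 →ₗ[ℝ] 𝔤 →ₗ[ℝ] 𝔤)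
    (ht : ∀ x y, nabla x y - nabla y x = ⁅x, y⁆) (x y z : 𝔤) :
    curvature nabla x y z + curvature nabla y z x + curvature nabla z x y = 0 := by
  have key (a b c : 𝔤) : ⁅a, ⁅b, c⁆⁆ = nabla a (nabla b c) - nabla a (nabla c b)
      - nabla ⁅b, c⁆ a := by
    rw [← ht a, ← map_sub, ht b c]
  have hj := lie_jacobi x y z
  rw [key, key, key] at hj
  rw [← hj]
  simp only [curvature, LinearMap.sub_apply, LinearMap.comp_apply]
  abel

namespace HermitianStructure

variable (h : HermitianStructure 𝔤)

theorem ext_g {x y : 𝔤} (H : ∀ z, h.g x z = h.g y z) : x = y := by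
  rw [← sub_eq_zero]
  by_contra hne
  have := h.pos _ hne
  rw [map_sub (h.g (x - y)), h.symm _ x, h.symm _ y, map_sub, map_sub, h.symm x y] at this
  linarith [H x, H y, h.symm x y]

theorem g_J_J (x y : 𝔤) : h.g (h.J x) (h.J y) = h.g x y := by
  rw [h.J_skew, h.J_sq, map_neg, neg_neg]

theorem dOmega_eq (x y z : 𝔤) :
    h.dOmega x y z = h.g ⁅x, y⁆ (h.J z) + h.g ⁅y, z⁆ (h.J x) + h.g ⁅z, x⁆ (h.J y) := by
  simp only [dOmega, omega, h.J_skew]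
  ring

/-- The image of an orthonormal basis under `J` is an orthonormal basis. -/
theorem exists_isOrthonormal_J {ι : Type*} [DecidableEq ι] {e : Module.Basis ι ℝ 𝔤}
    (he : h.g.IsOrthonormal e) :
    ∃ f : Module.Basis ι ℝ 𝔤, h.g.IsOrthonormal f ∧ ∀ i, f i = h.J (e i) := by
  let E : 𝔤 ≃ₗ[ℝ] 𝔤 := LinearEquiv.ofLinearMap h.J (-h.J)
    (by ext x; simp [h.J_sq]) (by ext x; simp [h.J_sq])
  refine ⟨e.map E, fun i j => ?_, fun i => rfl⟩
  change h.g (h.J (e i)) (h.J (e j)) = _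
  rw [h.g_J_J, he]

variable {ι : Type*} [Fintype ι] [DecidableEq ι] {e : Module.Basis ι ℝ 𝔤}

/-- On a unimodular Lie algebra the trace of `dω` over a complex pair of indices is the contraction
`∑ [eᵢ, Jeᵢ]` of the bracket: all other terms are traces of adjoint operators. -/
theorem omega_sum_lie_J (hu : IsUnimodular 𝔤) (he : h.g.IsOrthonormal e) (z : 𝔤) :
    h.omega (∑ i, ⁅e i, h.J (e i)⁆) z = -∑ i, h.dOmega (e i) (h.J (e i)) z := by
  obtain ⟨f, hf, hfe⟩ := h.exists_isOrthonormal_J he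
  have h1 := hu z
  have h2 := hu z
  rw [he.trace_eq_sum] at h1
  rw [hf.trace_eq_sum] at h2
  simp only [LieAlgebra.ad_apply, hfe] at h1 h2
  have h3 (i : ι) : h.dOmega (e i) (h.J (e i)) z = -h.omega ⁅e i, h.J (e i)⁆ z
      - h.g ⁅z, h.J (e i)⁆ (h.J (e i)) - h.g ⁅z, e i⁆ (e i) := by
    rw [h.dOmega_eq, omega, h.J_skew, h.J_sq, ← lie_skew z (h.J (e i))]
    simp only [map_neg, LinearMap.neg_apply]
    ring
  simp_rw [h3]
  rw [Finset.sum_sub_distrib, Finset.sum_sub_distrib, h1, h2, omega, map_sum, map_sum,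
    LinearMap.sum_apply]
  simp [omega]

variable [FiniteDimensional ℝ 𝔤]

theorem leviCivita_skew (x y z : 𝔤) :
    h.g (h.leviCivita x y) z = -h.g y (h.leviCivita x z) := by
  rw [h.symm y, h.g_leviCivita, h.g_leviCivita, ← lie_skew x y, ← lie_skew x z, ← lie_skew y z]
  simp only [map_neg, LinearMap.neg_apply]
  ring

theorem leviCivita_torsion_free (x y : 𝔤) :
    h.leviCivita x y - h.leviCivita y x = ⁅x, y⁆ := by
  refine h.ext_g fun z => ?_
  rw [map_sub, LinearMap.sub_apply, h.g_leviCivita, h.g_leviCivita, ← lie_skew y x,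
    ← lie_skew x z, ← lie_skew z y]
  simp only [map_neg, LinearMap.neg_apply]
  ring

/-- For an integrable `J`, the tensor `∇ᵍJ` is determined by `dω`. -/
theorem two_mul_g_leviCivita_J (x y z : 𝔤) :
    2 * h.g (h.leviCivita x (h.J y) - h.J (h.leviCivita x y)) z
      = h.dOmega x y z - h.dOmega x (h.J y) (h.J z) := by
  have hN := congrArg (fun w => h.g w (h.J x)) (h.integrable y z)
  simp only [map_sub, map_add, LinearMap.sub_apply, LinearMap.add_apply, h.g_J_J, map_zero,
    LinearMap.zero_apply] at hN
  rw [map_sub, LinearMap.sub_apply, h.J_skew, h.g_leviCivita, h.g_leviCivita, h.dOmega_eq,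
    h.dOmega_eq, h.J_sq, h.J_sq]
  simp only [map_neg]
  linarith

theorem leviCivita_J_of_dOmega_eq_zero (hK : ∀ x y z, h.dOmega x y z = 0) (x y : 𝔤) :
    h.leviCivita x (h.J y) = h.J (h.leviCivita x y) := by
  rw [← sub_eq_zero]
  refine h.ext_g fun z => ?_
  have := h.two_mul_g_leviCivita_J x y z
  rw [hK, hK] at this
  rw [map_zero, LinearMap.zero_apply]
  linarith

theorem curvature_skew (x y z w : 𝔤) :
    h.g (curvature h.leviCivita x y z) w = -h.g z (curvature h.leviCivita x y w) := by
  simp only [curvature, LinearMap.sub_apply, LinearMap.comp_apply, map_sub]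
  rw [h.leviCivita_skew x, h.leviCivita_skew y, h.leviCivita_skew y, h.leviCivita_skew x,
    h.leviCivita_skew _ z]
  ring

theorem sum_leviCivita_eq_zero (hu : IsUnimodular 𝔤) (he : h.g.IsOrthonormal e) :
    ∑ i, h.leviCivita (e i) (e i) = 0 := by
  refine h.ext_g fun z => ?_
  have htr := hu z
  rw [he.trace_eq_sum] at htr
  simp only [LieAlgebra.ad_apply] at htr
  rw [map_sum, LinearMap.sum_apply, map_zero, LinearMap.zero_apply, ← htr]
  refine Finset.sum_congr rfl fun i _ => ?_
  rw [h.g_leviCivita, lie_self, ← lie_skew (e i) z]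
  simp only [map_neg, LinearMap.neg_apply, map_zero, LinearMap.zero_apply]
  ring

end HermitianStructure

end VaismanLie

end

/-! ### Scalar curvature and structure constants -/

noncomputable section

namespace VaismanLie

section Sums

variable {ι : Type*} [Fintype ι]

theorem sum_swap₂₃ (F : ι → ι → ι → ℝ) :
    ∑ i, ∑ j, ∑ k, F i j k = ∑ i, ∑ j, ∑ k, F i k j :=
  Finset.sum_congr rfl fun _ _ => Finset.sum_comm

theorem sum_swap₁₂ (F : ι → ι → ι → ℝ) :
    ∑ i, ∑ j, ∑ k, F i j k = ∑ i, ∑ j, ∑ k, F j i k :=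
  Finset.sum_comm

/-- Contraction of connection coefficients `Γ` with the curvature term `∇_[eᵢ, eⱼ]`. -/
theorem sum_torsion_mul (Γ : ι → ι → ι → ℝ) (hΓ : ∀ i j k, Γ i j k = -Γ i k j) :
    ∑ i, ∑ j, ∑ k, (Γ i j k - Γ j i k) * Γ k j i = 2 * ∑ i, ∑ j, ∑ k, Γ i j k * Γ j i k := by
  have h1 : ∑ i, ∑ j, ∑ k, Γ i j k * Γ k j i = ∑ i, ∑ j, ∑ k, Γ i j k * Γ j i k := by
    rw [sum_swap₂₃]
    refine Finset.sum_congr rfl fun i _ => Finset.sum_congr rfl fun j _ =>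
      Finset.sum_congr rfl fun k _ => ?_
    rw [hΓ i k j, hΓ j k i]; ring
  have h2 : ∑ i, ∑ j, ∑ k, Γ j i k * Γ k j i = -∑ i, ∑ j, ∑ k, Γ i j k * Γ j i k := by
    rw [sum_swap₁₂, sum_swap₂₃]
    simp_rw [← Finset.sum_neg_distrib]
    refine Finset.sum_congr rfl fun i _ => Finset.sum_congr rfl fun j _ =>
      Finset.sum_congr rfl fun k _ => ?_
    rw [hΓ i k j]; ring
  simp only [sub_mul, Finset.sum_sub_distrib, h1, h2]
  ring

/-- The contraction `ΣΓᵢⱼₖΓⱼᵢₖ` of connection coefficients in terms of the structure constants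
`cᵢⱼₖ = Γᵢⱼₖ - Γⱼᵢₖ`. -/
theorem sum_structure_constants (Γ : ι → ι → ι → ℝ) (hΓ : ∀ i j k, Γ i j k = -Γ i k j) :
    ∑ i, ∑ j, ∑ k, (Γ i j k - Γ j i k) * (Γ i k j - Γ k i j)
      + 1 / 2 * ∑ i, ∑ j, ∑ k, (Γ i j k - Γ j i k) * (Γ i j k - Γ j i k)
      = 2 * ∑ i, ∑ j, ∑ k, Γ i j k * Γ j i k := by
  have h1 : ∑ i, ∑ j, ∑ k, Γ i j k * Γ i k j = -∑ i, ∑ j, ∑ k, Γ i j k * Γ i j k := by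
    simp_rw [← Finset.sum_neg_distrib]
    refine Finset.sum_congr rfl fun i _ => Finset.sum_congr rfl fun j _ =>
      Finset.sum_congr rfl fun k _ => ?_
    rw [hΓ i k j]; ring
  have h2 : ∑ i, ∑ j, ∑ k, Γ i j k * Γ k i j = -∑ i, ∑ j, ∑ k, Γ i j k * Γ j i k := by
    rw [sum_swap₂₃]
    simp_rw [← Finset.sum_neg_distrib]
    refine Finset.sum_congr rfl fun i _ => Finset.sum_congr rfl fun j _ =>
      Finset.sum_congr rfl fun k _ => ?_
    rw [hΓ i k j]; ring
  have h3 : ∑ i, ∑ j, ∑ k, Γ j i k * Γ i k j = -∑ i, ∑ j, ∑ k, Γ i j k * Γ j i k := by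
    simp_rw [← Finset.sum_neg_distrib]
    refine Finset.sum_congr rfl fun i _ => Finset.sum_congr rfl fun j _ =>
      Finset.sum_congr rfl fun k _ => ?_
    rw [hΓ i k j]; ring
  have h4 : ∑ i, ∑ j, ∑ k, Γ j i k * Γ k i j = ∑ i, ∑ j, ∑ k, Γ i j k * Γ j i k := by
    rw [sum_swap₁₂, sum_swap₂₃]
    refine Finset.sum_congr rfl fun i _ => Finset.sum_congr rfl fun j _ =>
      Finset.sum_congr rfl fun k _ => ?_
    rw [hΓ i k j, hΓ j k i]; ring
  have h5 : ∑ i, ∑ j, ∑ k, Γ j i k * Γ j i k = ∑ i, ∑ j, ∑ k, Γ i j k * Γ i j k :=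
    sum_swap₁₂ _
  have h6 : ∑ i, ∑ j, ∑ k, Γ j i k * Γ i j k = ∑ i, ∑ j, ∑ k, Γ i j k * Γ j i k :=
    sum_swap₁₂ _
  simp only [sub_mul, mul_sub, Finset.sum_sub_distrib, h1, h2, h3, h4, h5, h6]
  ring

theorem eq_zero_of_sum_nonpos {α β γ : Type*} [Fintype α] [Fintype β] [Fintype γ]
    (F : α → β → γ → ℝ) (hF : ∀ a b k, 0 ≤ F a b k) (hs : ∑ a, ∑ b, ∑ k, F a b k ≤ 0) (a : α)
    (b : β) (k : γ) : F a b k = 0 := by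
  have hs' := le_antisymm hs (Finset.sum_nonneg fun _ _ => Finset.sum_nonneg fun _ _ =>
    Finset.sum_nonneg fun _ _ => hF _ _ _)
  rw [Finset.sum_eq_zero_iff_of_nonneg (fun _ _ => Finset.sum_nonneg fun _ _ =>
    Finset.sum_nonneg fun _ _ => hF _ _ _)] at hs'
  have h2 := hs' a (Finset.mem_univ _)
  rw [Finset.sum_eq_zero_iff_of_nonneg (fun _ _ =>
    Finset.sum_nonneg fun _ _ => hF _ _ _)] at h2
  have h3 := h2 b (Finset.mem_univ _)
  rw [Finset.sum_eq_zero_iff_of_nonneg (fun _ _ => hF _ _ _)] at h3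
  exact h3 k (Finset.mem_univ _)

/-- If the index set splits so that `c` takes values in the second part and the Killing form of
`c` vanishes on the diagonal of the second part, then `B + ½|c|²` is a sum of squares, so its vanishing
forces each of these squares to vanish. -/
theorem structure_constants_of_sum_eq_zero {κ : Type*} [Fintype κ]
    (c : ι ⊕ κ → ι ⊕ κ → ι ⊕ κ → ℝ) (hc : ∀ i j k, c i j k = -c j i k)
    (hv : ∀ i j a, c i j (Sum.inl a) = 0)
    (hB : ∀ b, ∑ j, ∑ k, c (Sum.inr b) j k * c (Sum.inr b) k j = 0)
    (h0 : ∑ i, ∑ j, ∑ k, c i j k * c i k j + 1 / 2 * ∑ i, ∑ j, ∑ k, c i j k * c i j k = 0) :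
    (∀ a b k, c (Sum.inl a) (Sum.inl b) k = 0) ∧ (∀ a b k, c (Sum.inr a) (Sum.inr b) k = 0) ∧
      ∀ a b k, c (Sum.inl a) (Sum.inr b) (Sum.inr k)
        = -c (Sum.inl a) (Sum.inr k) (Sum.inr b) := by
  have hsymm : ∑ i : κ, ∑ j : ι, ∑ k : κ, c (Sum.inr i) (Sum.inl j) (Sum.inr k)
        * c (Sum.inr i) (Sum.inl j) (Sum.inr k)
      = ∑ i : ι, ∑ j : κ, ∑ k : κ, c (Sum.inl i) (Sum.inr j) (Sum.inr k)
        * c (Sum.inl i) (Sum.inr j) (Sum.inr k) := by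
    rw [Finset.sum_comm]
    refine Finset.sum_congr rfl fun i _ => Finset.sum_congr rfl fun j _ =>
      Finset.sum_congr rfl fun k _ => ?_
    rw [hc (Sum.inl i)]; ring
  have hsq : ∑ a : ι, ∑ j : κ, ∑ k : κ,
        (c (Sum.inl a) (Sum.inr j) (Sum.inr k) + c (Sum.inl a) (Sum.inr k) (Sum.inr j)) ^ 2
      = 2 * ∑ a : ι, ∑ j : κ, ∑ k : κ, c (Sum.inl a) (Sum.inr j) (Sum.inr k)
          * c (Sum.inl a) (Sum.inr j) (Sum.inr k)
        + 2 * ∑ a : ι, ∑ j : κ, ∑ k : κ, c (Sum.inl a) (Sum.inr j) (Sum.inr k)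
          * c (Sum.inl a) (Sum.inr k) (Sum.inr j) := by
    have h1 : ∑ a : ι, ∑ j : κ, ∑ k : κ, c (Sum.inl a) (Sum.inr k) (Sum.inr j)
          * c (Sum.inl a) (Sum.inr k) (Sum.inr j)
        = ∑ a : ι, ∑ j : κ, ∑ k : κ, c (Sum.inl a) (Sum.inr j) (Sum.inr k)
          * c (Sum.inl a) (Sum.inr j) (Sum.inr k) :=
      Finset.sum_congr rfl fun _ _ => Finset.sum_comm
    have h2 (x y : ℝ) : (x + y) ^ 2 = x * x + y * y + 2 * (x * y) := by ring
    simp only [h2, Finset.sum_add_distrib, h1, ← Finset.mul_sum]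
    ring
  simp only [Fintype.sum_sum_type (α₁ := ι) (α₂ := κ), hv, mul_zero, zero_mul,
    Finset.sum_const_zero, zero_add, Finset.sum_add_distrib] at h0 hB
  simp only [hB, Finset.sum_const_zero, add_zero, hsymm] at h0
  have hn1 : 0 ≤ ∑ a : ι, ∑ j : κ, ∑ k : κ,
      (c (Sum.inl a) (Sum.inr j) (Sum.inr k) + c (Sum.inl a) (Sum.inr k) (Sum.inr j)) ^ 2 :=
    Finset.sum_nonneg fun _ _ => Finset.sum_nonneg fun _ _ => Finset.sum_nonneg fun _ _ =>
      sq_nonneg _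
  have hn2 : 0 ≤ ∑ a : ι, ∑ j : ι, ∑ k : κ, c (Sum.inl a) (Sum.inl j) (Sum.inr k)
      * c (Sum.inl a) (Sum.inl j) (Sum.inr k) :=
    Finset.sum_nonneg fun _ _ => Finset.sum_nonneg fun _ _ => Finset.sum_nonneg fun _ _ =>
      mul_self_nonneg _
  have hn3 : 0 ≤ ∑ a : κ, ∑ j : κ, ∑ k : κ, c (Sum.inr a) (Sum.inr j) (Sum.inr k)
      * c (Sum.inr a) (Sum.inr j) (Sum.inr k) :=
    Finset.sum_nonneg fun _ _ => Finset.sum_nonneg fun _ _ => Finset.sum_nonneg fun _ _ =>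
      mul_self_nonneg _
  refine ⟨fun a b k => ?_, fun a b k => ?_, fun a b k => ?_⟩
  · rcases k with k | k
    · exact hv _ _ _
    · exact mul_self_eq_zero.1 (eq_zero_of_sum_nonpos
        (fun a j k => c (Sum.inl a) (Sum.inl j) (Sum.inr k)
        * c (Sum.inl a) (Sum.inl j) (Sum.inr k)) (fun _ _ _ => mul_self_nonneg _)
        (by linarith) a b k)
  · rcases k with k | k
    · exact hv _ _ _
    · exact mul_self_eq_zero.1 (eq_zero_of_sum_nonpos
        (fun a j k => c (Sum.inr a) (Sum.inr j) (Sum.inr k)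
        * c (Sum.inr a) (Sum.inr j) (Sum.inr k)) (fun _ _ _ => mul_self_nonneg _)
        (by linarith) a b k)
  · exact eq_neg_of_add_eq_zero_left (pow_eq_zero_iff two_ne_zero |>.1 (eq_zero_of_sum_nonpos
      (fun a j k => (c (Sum.inl a) (Sum.inr j) (Sum.inr k)
        + c (Sum.inl a) (Sum.inr k) (Sum.inr j)) ^ 2) (fun _ _ _ => sq_nonneg _)
        (by linarith) a b k))

end Sums

variable {𝔤 : Type*} [LieRing 𝔤] [LieAlgebra ℝ 𝔤]

namespace HermitianStructure

variable (h : HermitianStructure 𝔤) [FiniteDimensional ℝ 𝔤]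
  {ι : Type*} [Fintype ι] [DecidableEq ι] {e : Module.Basis ι ℝ 𝔤}

/-- The scalar curvature of a unimodular metric Lie algebra in terms of the connection
coefficients. -/
theorem scalarCurvature_eq (hu : IsUnimodular 𝔤) (he : h.g.IsOrthonormal e) :
    ∑ i, ∑ j, h.g (curvature h.leviCivita (e i) (e j) (e j)) (e i)
      = -∑ i, ∑ j, ∑ k, h.g (h.leviCivita (e i) (e j)) (e k)
          * h.g (h.leviCivita (e j) (e i)) (e k) := by
  have hsk (i j k : ι) : h.g (h.leviCivita (e i) (e j)) (e k)
      = -h.g (h.leviCivita (e i) (e k)) (e j) := by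
    rw [h.leviCivita_skew, h.symm]
  -- the only term that uses unimodularity
  have h1 : ∑ i, ∑ j, h.g (h.leviCivita (e i) (h.leviCivita (e j) (e j))) (e i) = 0 := by
    have (i : ι) : ∑ j, h.g (h.leviCivita (e i) (h.leviCivita (e j) (e j))) (e i)
        = h.g (h.leviCivita (e i) (∑ j, h.leviCivita (e j) (e j))) (e i) := by
      simp only [map_sum, LinearMap.sum_apply]
    simp [this, h.sum_leviCivita_eq_zero hu he]
  have h2 (i j : ι) : h.g (h.leviCivita (e j) (h.leviCivita (e i) (e j))) (e i)
      = -∑ k, h.g (h.leviCivita (e i) (e j)) (e k) * h.g (h.leviCivita (e j) (e i)) (e k) := by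
    rw [h.leviCivita_skew, ← he.sum_mul]
    simp_rw [h.symm (e _) (h.leviCivita _ _)]
  have h3 (i j : ι) : h.g (h.leviCivita ⁅e i, e j⁆ (e j)) (e i)
      = ∑ k, (h.g (h.leviCivita (e i) (e j)) (e k) - h.g (h.leviCivita (e j) (e i)) (e k))
        * h.g (h.leviCivita (e k) (e j)) (e i) := by
    conv_lhs => rw [← he.sum_smul ⁅e i, e j⁆]
    simp only [map_sum, map_smul, LinearMap.sum_apply, LinearMap.smul_apply, smul_eq_mul]
    simp_rw [← h.leviCivita_torsion_free (e i), map_sub, LinearMap.sub_apply]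
  simp only [curvature, LinearMap.sub_apply, LinearMap.comp_apply, map_sub,
    Finset.sum_sub_distrib, h1, h2, h3, Finset.sum_neg_distrib]
  rw [sum_torsion_mul _ hsk]
  ring

/-- A unimodular Kähler Lie algebra has vanishing scalar curvature. The Ricci form
`(x, y) ↦ tr (J R(x, y)) = -tr (J ∇_[x, y])` is contracted with `J` in two ways: the vector
`∑ [eᵢ, Jeᵢ]` vanishes, while by the Bianchi identity one gets twice the scalar curvature. -/
theorem scalarCurvature_eq_zero (hu : IsUnimodular 𝔤) (hK : ∀ x y z, h.dOmega x y z = 0)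
    (he : h.g.IsOrthonormal e) :
    ∑ i, ∑ j, h.g (curvature h.leviCivita (e i) (e j) (e j)) (e i) = 0 := by
  have hJ := h.leviCivita_J_of_dOmega_eq_zero hK
  have hRJ (x y z : 𝔤) : curvature h.leviCivita x y (h.J z)
      = h.J (curvature h.leviCivita x y z) := by
    simp only [curvature, LinearMap.sub_apply, LinearMap.comp_apply, hJ, map_sub]
  obtain ⟨f, hf, hfe⟩ := h.exists_isOrthonormal_J he
  have hW : ∑ i, ⁅e i, h.J (e i)⁆ = 0 := by
    have hJW : h.J (∑ i, ⁅e i, h.J (e i)⁆) = 0 := by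
      refine h.ext_g fun z => ?_
      have := h.omega_sum_lie_J hu he z
      simpa [hK, omega] using this
    rw [← neg_eq_zero, ← h.J_sq, hJW, map_zero]
  have hRic (x y : 𝔤) : ∑ j, h.g (curvature h.leviCivita x y (e j)) (h.J (e j))
      = LinearMap.trace ℝ 𝔤 (h.J ∘ₗ h.leviCivita ⁅x, y⁆) := by
    have h1 : LinearMap.trace ℝ 𝔤 (h.J ∘ₗ (h.leviCivita x ∘ₗ h.leviCivita y))
        = LinearMap.trace ℝ 𝔤 (h.J ∘ₗ (h.leviCivita y ∘ₗ h.leviCivita x)) := by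
      have hc : h.J ∘ₗ (h.leviCivita x ∘ₗ h.leviCivita y)
          = h.leviCivita x ∘ₗ (h.J ∘ₗ h.leviCivita y) := by
        ext z; simp [hJ]
      rw [hc, LinearMap.trace_comp_comm', LinearMap.comp_assoc]
    have h2 : ∑ j, h.g (curvature h.leviCivita x y (e j)) (h.J (e j))
        = -LinearMap.trace ℝ 𝔤 (h.J ∘ₗ curvature h.leviCivita x y) := by
      rw [he.trace_eq_sum, ← Finset.sum_neg_distrib]
      refine Finset.sum_congr rfl fun j _ => ?_
      rw [LinearMap.comp_apply, h.J_skew, neg_neg]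
    rw [h2, curvature, LinearMap.comp_sub, LinearMap.comp_sub, map_sub, map_sub, h1]
    ring
  -- first evaluation: the sum over `i` produces `∇` in the direction `∑ [eᵢ, Jeᵢ] = 0`
  have hΩ : ∑ i, ∑ j, h.g (curvature h.leviCivita (e i) (h.J (e i)) (e j)) (h.J (e j)) = 0 := by
    simp_rw [hRic]
    simp_rw [← Module.End.mul_eq_comp]
    rw [← map_sum, ← Finset.mul_sum, ← map_sum, hW]
    simp
  -- second evaluation: by the Bianchi identity each term splits into two scalar curvature terms,
  -- one of them in the rotated basis `f = Je`
  have hB (i j : ι) : h.g (curvature h.leviCivita (e i) (h.J (e i)) (e j)) (h.J (e j))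
      = -h.g (curvature h.leviCivita (f i) (e j) (e j)) (f i)
        - h.g (curvature h.leviCivita (e i) (e j) (e j)) (e i) := by
    have hb := curvature_bianchi h.leviCivita h.leviCivita_torsion_free (e i) (f i) (e j)
    have hb' := congrArg (fun w => h.g w (h.J (e j))) hb
    have hei : e i = -h.J (f i) := by rw [hfe, h.J_sq, neg_neg]
    have t1 : h.g (curvature h.leviCivita (f i) (e j) (e i)) (h.J (e j))
        = h.g (curvature h.leviCivita (f i) (e j) (e j)) (f i) := by
      conv_lhs => rw [hei]
      rw [map_neg, hRJ, map_neg, LinearMap.neg_apply, h.g_J_J, h.curvature_skew, h.symm (f i)]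
      ring
    have t2 : h.g (curvature h.leviCivita (e j) (e i) (f i)) (h.J (e j))
        = h.g (curvature h.leviCivita (e i) (e j) (e j)) (e i) := by
      rw [hfe, hRJ, h.g_J_J, curvature_swap, LinearMap.neg_apply, map_neg, LinearMap.neg_apply,
        h.curvature_skew, h.symm (e i)]
      ring
    simp only [map_add, LinearMap.add_apply, map_zero, LinearMap.zero_apply] at hb'
    rw [t1, t2] at hb'
    rw [← hfe i]
    linarith
  have hinv : ∑ i, ∑ j, h.g (curvature h.leviCivita (f i) (e j) (e j)) (f i)
      = ∑ i, ∑ j, h.g (curvature h.leviCivita (e i) (e j) (e j)) (e i) := by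
    rw [Finset.sum_comm, Finset.sum_comm (f := fun i j =>
      h.g (curvature h.leviCivita (e i) (e j) (e j)) (e i))]
    refine Finset.sum_congr rfl fun j _ => ?_
    let F : 𝔤 →ₗ[ℝ] 𝔤 →ₗ[ℝ] ℝ := h.g ∘ₗ
      (((curvatureBilin h.leviCivita).flip (e j)).flip (e j))
    exact he.sum_apply_self_eq h.symm hf F
  simp_rw [hB, Finset.sum_sub_distrib, Finset.sum_neg_distrib] at hΩ
  linarith

end HermitianStructure

end VaismanLie

end

/-! ### Flatness of Kähler Lie algebras -/

noncomputable section

namespace VaismanLie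

namespace HermitianStructure

variable {𝔤 : Type*} [LieRing 𝔤] [LieAlgebra ℝ 𝔤] (h : HermitianStructure 𝔤)
  [FiniteDimensional ℝ 𝔤]

/-- Hano's theorem in the form used here: a unimodular Kähler Lie algebra is flat as soon as the
Killing form satisfies `B(x, x) = 0` on the derived algebra, which holds for solvable ones. -/
theorem curvature_eq_zero_of_kaehler (hu : IsUnimodular 𝔤)
    (hB : ∀ x ∈ Submodule.span ℝ {m : 𝔤 | ∃ y z : 𝔤, ⁅y, z⁆ = m},
      LinearMap.trace ℝ 𝔤 (LieAlgebra.ad ℝ 𝔤 x ∘ₗ LieAlgebra.ad ℝ 𝔤 x) = 0)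
    (hK : ∀ x y z, h.dOmega x y z = 0) (x y : 𝔤) : curvature h.leviCivita x y = 0 := by
  set W := Submodule.span ℝ {m : 𝔤 | ∃ y z : 𝔤, ⁅y, z⁆ = m} with hW
  have hWmem (x y : 𝔤) : ⁅x, y⁆ ∈ W := Submodule.subset_span ⟨x, y, rfl⟩
  obtain ⟨m, n, e, he, hl, hr⟩ :=
    LinearMap.BilinForm.exists_isOrthonormal_basis_adapted h.g h.symm h.pos W
  set Γ : Fin m ⊕ Fin n → Fin m ⊕ Fin n → Fin m ⊕ Fin n → ℝ :=
    fun i j k => h.g (h.leviCivita (e i) (e j)) (e k) with hΓdef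
  set c : Fin m ⊕ Fin n → Fin m ⊕ Fin n → Fin m ⊕ Fin n → ℝ :=
    fun i j k => h.g ⁅e i, e j⁆ (e k) with hcdef
  have hΓ (i j k) : Γ i j k = -Γ i k j := by
    simp only [hΓdef]
    rw [h.leviCivita_skew, h.symm]
  have hcΓ (i j k) : c i j k = Γ i j k - Γ j i k := by
    simp only [hcdef, hΓdef]
    rw [← h.leviCivita_torsion_free, map_sub, LinearMap.sub_apply]
  have hcs (i j k) : c i j k = -c j i k := by rw [hcΓ, hcΓ]; ring
  have hcv (i j a) : c i j (Sum.inl a) = 0 := hl a _ (hWmem _ _)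
  -- the Killing form, written with structure constants
  have hcB (b) : ∑ j, ∑ k, c (Sum.inr b) j k * c (Sum.inr b) k j = 0 := by
    have h1 := hB _ (hr b)
    rw [he.trace_eq_sum] at h1
    rw [← h1]
    refine Finset.sum_congr rfl fun j _ => ?_
    simp only [LinearMap.comp_apply, LieAlgebra.ad_apply, hcdef]
    conv_rhs => rw [← he.sum_smul ⁅e (Sum.inr b), e j⁆]
    simp only [lie_sum, lie_smul, map_sum, map_smul, LinearMap.sum_apply, LinearMap.smul_apply,
      smul_eq_mul]
  have hT := h.scalarCurvature_eq_zero hu hK he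
  rw [h.scalarCurvature_eq hu he, neg_eq_zero] at hT
  have h0 : ∑ i, ∑ j, ∑ k, c i j k * c i k j + 1 / 2 * ∑ i, ∑ j, ∑ k, c i j k * c i j k = 0 := by
    have h1 := sum_structure_constants Γ hΓ
    simp only [← hcΓ] at h1
    rw [h1]
    simp only [hΓdef, hT, mul_zero]
  obtain ⟨hll, hrr, hlr⟩ := structure_constants_of_sum_eq_zero c hcs hcv hcB h0
  have hLC (i j k) : Γ i j k = 1 / 2 * (c i j k - c j k i + c k i j) := h.g_leviCivita _ _ _
  have hrl (a b k) : c (Sum.inr b) (Sum.inl a) (Sum.inr k)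
      = -c (Sum.inr k) (Sum.inl a) (Sum.inr b) := by
    rw [hcs, hlr, neg_neg, hcs (Sum.inr k), neg_neg]
  -- directions in the derived algebra are parallel
  have hnr (b) : h.leviCivita (e (Sum.inr b)) = 0 := by
    refine e.ext fun j => he.ext fun k => ?_
    have : Γ (Sum.inr b) j k = 0 := by
      rw [hLC]
      rcases j with j | j <;> rcases k with k | k
      · simp only [hcv, hll]; ring
      · rw [hcv, hrl, hcs (Sum.inl j)]; ring
      · rw [hcv, hrl k j b, hcs (Sum.inl k)]; ring
      · simp only [hrr]; ring
    simpa using this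
  -- orthogonal directions differentiate by their adjoint action
  have hnl (a) : h.leviCivita (e (Sum.inl a)) = LieAlgebra.ad ℝ 𝔤 (e (Sum.inl a)) := by
    refine e.ext fun j => he.ext fun k => ?_
    have : Γ (Sum.inl a) j k = c (Sum.inl a) j k := by
      rw [hLC]
      rcases j with j | j <;> rcases k with k | k
      · simp only [hcv]; ring
      · simp only [hcv, hll]; ring
      · simp only [hcv, hll]; ring
      · rw [hcv, hcs (Sum.inr k) (Sum.inl a), hlr a k j]; ring
    exact this
  have hnW (w : 𝔤) (hw : w ∈ W) : h.leviCivita w = 0 := by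
    rw [← he.sum_smul w]
    simp [Fintype.sum_sum_type, hl _ _ hw, hnr]
  have hzero : curvatureBilin h.leviCivita = 0 := by
    refine LinearMap.ext_basis e e fun i j => ?_
    rw [curvatureBilin_apply, curvature, hnW _ (hWmem _ _)]
    rcases i with i | i <;> rcases j with j | j
    · have hab : ⁅e (Sum.inl i), e (Sum.inl j)⁆ = 0 := by
        refine he.ext fun k => ?_
        rw [map_zero, LinearMap.zero_apply]
        exact hll i j k
      rw [hnl, hnl]
      ext z
      simp [← lie_lie, hab]
    all_goals simp [hnr]
  rw [← curvatureBilin_apply, hzero]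
  rfl

end HermitianStructure

end VaismanLie

end

/-! ### The Lee and anti-Lee vectors -/

noncomputable section

namespace VaismanLie

namespace VaismanStructure

variable {𝔤 : Type*} [LieRing 𝔤] [LieAlgebra ℝ 𝔤] [FiniteDimensional ℝ 𝔤]
  (V : VaismanStructure 𝔤)

/-- The anti-Lee vector `ξ = JA`. -/
def xi : 𝔤 := V.J V.A

/-- The 1-form `η = Jθ` dual to `ξ`. -/
def eta : Module.Dual ℝ 𝔤 := V.g V.xi

theorem g_xi (x : 𝔤) : V.g V.xi x = V.eta x := rfl

theorem J_xi : V.J V.xi = -V.A := V.J_sq _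

theorem theta_J (x : 𝔤) : V.θ (V.J x) = -V.eta x := by
  rw [← V.g_A, ← V.g_xi, xi, V.J_skew, neg_neg]

theorem eta_J (x : 𝔤) : V.eta (V.J x) = V.θ x := by
  rw [← V.g_xi, xi, V.g_J_J, V.g_A]

theorem eta_A : V.eta V.A = 0 := by
  have h1 : V.eta V.A = V.g V.A V.xi := V.symm _ _
  have h2 : V.g V.A V.xi = V.θ (V.J V.A) := V.g_A _
  rw [V.theta_J] at h2
  linarith

theorem theta_xi : V.θ V.xi = 0 := by
  rw [xi, theta_J, eta_A, neg_zero]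

theorem g_J_A (x : 𝔤) : V.g (V.J x) V.A = -V.eta x := by
  rw [V.symm, V.g_A, V.theta_J]

theorem phi_apply (x : 𝔤) : V.phi x = V.J x - V.θ x • V.xi + V.eta x • V.A := by
  simp [phi, V.theta_J, xi]

theorem g_phi (x y : 𝔤) :
    V.g (V.phi x) y = V.g (V.J x) y - V.θ x * V.eta y + V.eta x * V.θ y := by
  rw [phi_apply]
  simp [V.g_xi, V.g_A]

theorem phi_skew (x y : 𝔤) : V.g (V.phi x) y = -V.g x (V.phi y) := by
  rw [V.symm x, V.g_phi, V.g_phi, V.J_skew, V.symm x]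
  ring

/-- The Lee vector is Killing. -/
theorem lie_A_skew (x y : 𝔤) : V.g ⁅V.A, x⁆ y = -V.g x ⁅V.A, y⁆ := by
  have h1 := V.parallel x y
  rw [← V.g_A, V.symm, V.g_leviCivita, V.symm _ V.A, V.g_A, V.closed, ← lie_skew y] at h1
  simp only [map_neg, LinearMap.neg_apply] at h1
  rw [V.symm x]
  linarith

variable {V}

theorem theta_A (hA : V.g V.A V.A = 1) : V.θ V.A = 1 := by rw [← V.g_A, hA]

theorem eta_xi (hA : V.g V.A V.A = 1) : V.eta V.xi = 1 := by
  rw [← V.g_xi, xi, V.g_J_J, hA]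

/-- The Lee vector is holomorphic, since `A` is `∇ᵍ`-parallel and `∇ᵍ_A J = 0`. -/
theorem lie_A_J (hA : V.g V.A V.A = 1) (x : 𝔤) : ⁅V.A, V.J x⁆ = V.J ⁅V.A, x⁆ := by
  have hpar (y : 𝔤) : V.leviCivita y V.A = 0 := by
    refine V.ext_g fun z => ?_
    rw [V.leviCivita_skew, V.g_A, V.parallel]
    simp
  have hbr (y : 𝔤) : ⁅V.A, y⁆ = V.leviCivita V.A y := by
    rw [← V.leviCivita_torsion_free, hpar, sub_zero]
  rw [hbr, hbr, ← sub_eq_zero]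
  refine V.ext_g fun z => ?_
  have h1 := V.two_mul_g_leviCivita_J V.A x z
  rw [V.lck, V.lck] at h1
  simp only [HermitianStructure.omega, V.J_sq, V.theta_J, V.g_J_J, theta_A hA, map_neg,
    LinearMap.neg_apply, V.g_J_A] at h1
  rw [V.symm z V.A, V.g_A, V.g_A, V.J_skew x z, ← xi, V.g_xi] at h1
  rw [map_zero, LinearMap.zero_apply]
  linarith

theorem eta_lie (hA : V.g V.A V.A = 1) (x y : 𝔤) : V.eta ⁅x, y⁆ = V.g (V.phi x) y := by
  have h1 := V.lck V.A x y
  have h2 : V.g (V.J ⁅V.A, x⁆) y = -V.g (V.J x) ⁅V.A, y⁆ := by rw [← lie_A_J hA, V.lie_A_skew]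
  have h3 : V.g (V.J ⁅y, V.A⁆) x = V.g (V.J x) ⁅V.A, y⁆ := by
    rw [← lie_skew, map_neg, map_neg, LinearMap.neg_apply, V.J_skew, neg_neg, V.symm]
  rw [HermitianStructure.dOmega] at h1
  simp only [HermitianStructure.omega, theta_A hA, h2, h3, V.g_J_A] at h1
  rw [← xi, V.g_xi] at h1
  rw [V.g_phi]
  linarith

/-- The anti-Lee vector is holomorphic. -/
theorem lie_xi_J (hA : V.g V.A V.A = 1) (x : 𝔤) : ⁅V.xi, V.J x⁆ = V.J ⁅V.xi, x⁆ := by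
  have h1 := V.integrable V.A x
  rw [lie_A_J hA, map_add, V.J_sq, ← xi] at h1
  rw [← sub_eq_zero, ← h1]
  abel

/-- The anti-Lee vector is Killing: it is holomorphic and preserves `ω`. -/
theorem lie_xi_skew (hA : V.g V.A V.A = 1) (x y : 𝔤) : V.g ⁅V.xi, x⁆ y = -V.g x ⁅V.xi, y⁆ := by
  have h1 := V.lck V.xi x (V.J y)
  have h2 : V.g ⁅V.J y, V.xi⁆ (V.J x) = -V.g x ⁅V.xi, y⁆ := by
    rw [← lie_skew, lie_xi_J hA, map_neg, LinearMap.neg_apply, V.g_J_J, V.symm]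
  rw [V.dOmega_eq, V.J_sq, h2, J_xi] at h1
  simp only [HermitianStructure.omega, V.theta_xi, V.J_sq, V.theta_J, J_xi, map_neg,
    LinearMap.neg_apply] at h1
  rw [V.symm ⁅x, V.J y⁆, V.symm y V.xi, V.g_A, V.g_A, V.closed, V.g_xi] at h1
  linarith

/-- In a solvable unimodular Vaisman Lie algebra the anti-Lee vector is central. It is Killing, so
it suffices that `tr (ad ξ)² = 0`, which holds as soon as `ξ` lies in the derived algebra. By
unimodularity `∑ [eᵢ, Jeᵢ] = (dim 𝔤 - 2) ξ`, so this is the case if `dim 𝔤 ≠ 2`; in dimension two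
the algebra is spanned by the commuting vectors `A` and `ξ`. -/
theorem lie_xi_eq_zero [LieAlgebra.IsSolvable 𝔤] (hu : IsUnimodular 𝔤) (hA : V.g V.A V.A = 1)
    (x : 𝔤) : ⁅V.xi, x⁆ = 0 := by
  by_cases hdim : Module.finrank ℝ 𝔤 = 2
  · have hli : LinearIndependent ℝ ![V.A, V.xi] := by
      rw [LinearIndependent.pair_iff]
      intro s t hst
      have h1 := congrArg V.θ hst
      have h2 := congrArg V.eta hst
      simp only [map_add, map_smul, smul_eq_mul, theta_A hA, V.theta_xi, V.eta_A, eta_xi hA,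
        map_zero] at h1 h2
      constructor <;> linarith
    have hx : x ∈ Submodule.span ℝ (Set.range ![V.A, V.xi]) := by
      rw [hli.span_eq_top_of_card_eq_finrank (by simp [hdim])]
      trivial
    rw [Matrix.range_cons_cons_empty, Submodule.mem_span_pair] at hx
    obtain ⟨a, b, rfl⟩ := hx
    have h1 : ⁅V.xi, V.A⁆ = 0 := by
      rw [← lie_skew, xi, lie_A_J hA, lie_self, map_zero, neg_zero]
    rw [lie_add, lie_smul, lie_smul, h1, lie_self, smul_zero, smul_zero, add_zero]
  · obtain ⟨e, he⟩ := LinearMap.BilinForm.exists_isOrthonormal_basis V.g V.symm V.pos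
    have hW : ∑ i, ⁅e i, V.J (e i)⁆ = ((Module.finrank ℝ 𝔤 : ℝ) - 2) • V.xi := by
      have hJW : V.J (∑ i, ⁅e i, V.J (e i)⁆) = -((Module.finrank ℝ 𝔤 : ℝ) - 2) • V.A := by
        refine V.ext_g fun z => ?_
        have h1 := V.omega_sum_lie_J hu he z
        have h2 (i) : V.dOmega (e i) (V.J (e i)) z
            = -(V.g V.A (e i) * V.g (e i) z) - V.g V.xi (e i) * V.g (e i) (V.J z) + V.θ z := by
          rw [V.lck]
          simp only [HermitianStructure.omega, V.J_sq, V.theta_J, V.g_J_J, he i i, V.g_A, V.g_xi,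
            V.symm (V.J z), map_neg, LinearMap.neg_apply, if_true]
          ring
        simp only [h2, Finset.sum_add_distrib, Finset.sum_sub_distrib, Finset.sum_neg_distrib,
          he.sum_mul, Finset.sum_const, Finset.card_univ, Fintype.card_fin, nsmul_eq_mul] at h1
        rw [HermitianStructure.omega, V.g_A, V.g_xi, V.eta_J] at h1
        rw [h1, map_smul, LinearMap.smul_apply, V.g_A, smul_eq_mul]
        ring
      have h3 := congrArg V.J hJW
      rw [V.J_sq, map_smul, ← xi, neg_smul] at h3
      exact neg_injective h3
    have hne : (Module.finrank ℝ 𝔤 : ℝ) - 2 ≠ 0 := by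
      rw [sub_ne_zero]
      exact_mod_cast hdim
    have hmem : V.xi ∈ Submodule.span ℝ {m : 𝔤 | ∃ y z : 𝔤, ⁅y, z⁆ = m} := by
      rw [← inv_smul_smul₀ hne V.xi, ← hW]
      exact Submodule.smul_mem _ _ (Submodule.sum_mem _ fun i _ =>
        Submodule.subset_span ⟨_, _, rfl⟩)
    have htr := LieAlgebra.trace_ad_comp_ad_eq_zero_of_isSolvable hmem
    rw [he.trace_eq_sum] at htr
    simp only [LinearMap.comp_apply, LieAlgebra.ad_apply, lie_xi_skew hA ⁅V.xi, _⁆,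
      Finset.sum_neg_distrib, neg_eq_zero] at htr
    have hnn (y : 𝔤) : 0 ≤ V.g y y := by
      rcases eq_or_ne y 0 with rfl | hy
      · simp
      · exact (V.pos y hy).le
    rw [Finset.sum_eq_zero_iff_of_nonneg fun i _ => hnn _] at htr
    have had : LieAlgebra.ad ℝ 𝔤 V.xi = 0 := by
      refine e.ext fun i => ?_
      by_contra hne
      exact (V.pos _ hne).ne' (htr i (Finset.mem_univ i))
    rw [← LieAlgebra.ad_apply (R := ℝ), had, LinearMap.zero_apply]

end VaismanStructure

end VaismanLie

end

/-! ### Splitting off the anti-Lee vector -/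

noncomputable section

namespace VaismanLie

namespace VaismanStructure

variable {𝔤 : Type*} [LieRing 𝔤] [LieAlgebra ℝ 𝔤] [FiniteDimensional ℝ 𝔤]

/-- The bracket `[x, y] - η([x, y]) ξ`, with the `ξ`-component of the original one removed. -/
def bracket (V : VaismanStructure 𝔤) (x y : 𝔤) : 𝔤 := ⁅x, y⁆ - V.eta ⁅x, y⁆ • V.xi

section Bracket

variable {V : VaismanStructure 𝔤}

theorem lie_bracket (hc : ∀ x : 𝔤, ⁅V.xi, x⁆ = 0) (x y z : 𝔤) :
    ⁅x, V.bracket y z⁆ = ⁅x, ⁅y, z⁆⁆ := by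
  rw [bracket, lie_sub, lie_smul, ← lie_skew x V.xi, hc]
  simp

theorem bracket_lie (hc : ∀ x : 𝔤, ⁅V.xi, x⁆ = 0) (x y z : 𝔤) :
    ⁅V.bracket x y, z⁆ = ⁅⁅x, y⁆, z⁆ := by
  rw [bracket, sub_lie, smul_lie, hc]
  simp

theorem bracket_add_left (x y z : 𝔤) :
    V.bracket (x + y) z = V.bracket x z + V.bracket y z := by
  simp only [bracket, add_lie, map_add, add_smul]
  abel

theorem bracket_add_right (x y z : 𝔤) :
    V.bracket x (y + z) = V.bracket x y + V.bracket x z := by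
  simp only [bracket, lie_add, map_add, add_smul]
  abel

theorem bracket_smul_right (r : ℝ) (x y : 𝔤) : V.bracket x (r • y) = r • V.bracket x y := by
  simp only [bracket, lie_smul, map_smul, smul_sub, smul_smul, smul_eq_mul]

theorem bracket_self (x : 𝔤) : V.bracket x x = 0 := by
  simp [bracket]

theorem bracket_swap (x y : 𝔤) : V.bracket x y = -V.bracket y x := by
  rw [bracket, bracket, ← lie_skew x y, map_neg]
  simp only [neg_smul]
  abel

theorem bracket_leibniz (hc : ∀ x : 𝔤, ⁅V.xi, x⁆ = 0) (x y z : 𝔤) :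
    V.bracket x (V.bracket y z) = V.bracket (V.bracket x y) z + V.bracket y (V.bracket x z) := by
  rw [bracket, lie_bracket hc, bracket.eq_1 V (V.bracket x y), bracket_lie hc,
    bracket.eq_1 V y, lie_bracket hc, leibniz_lie x y z, map_add, add_smul]
  abel

theorem bracket_A (hA : V.g V.A V.A = 1) (x : 𝔤) : V.bracket V.A x = ⁅V.A, x⁆ := by
  rw [bracket, eta_lie hA, V.g_phi, theta_A hA, V.eta_A, ← xi, V.g_xi]
  simp

theorem eta_bracket (hA : V.g V.A V.A = 1) (x y : 𝔤) : V.eta (V.bracket x y) = 0 := by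
  simp [bracket, eta_xi hA]

theorem theta_bracket (x y : 𝔤) : V.θ (V.bracket x y) = 0 := by
  simp [bracket, V.closed, V.theta_xi]

theorem bracket_integrable (hA : V.g V.A V.A = 1) (x y : 𝔤) :
    V.bracket (V.J x) (V.J y) - V.bracket x y
      - V.J (V.bracket (V.J x) y + V.bracket x (V.J y)) = 0 := by
  have h2 : V.eta ⁅V.J x, V.J y⁆ = V.eta ⁅x, y⁆ := by
    rw [eta_lie hA, eta_lie hA, V.g_phi, V.g_phi]
    simp only [V.theta_J, V.eta_J, V.g_J_J]
    ring
  have h3 : V.eta ⁅V.J x, y⁆ + V.eta ⁅x, V.J y⁆ = 0 := by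
    rw [eta_lie hA, eta_lie hA, V.g_phi, V.g_phi]
    simp only [V.theta_J, V.eta_J, V.g_J_J, V.J_sq, map_neg, LinearMap.neg_apply]
    ring
  have h4 : V.bracket (V.J x) y + V.bracket x (V.J y) = ⁅V.J x, y⁆ + ⁅x, V.J y⁆ := by
    rw [bracket, bracket, eq_neg_of_add_eq_zero_left h3, neg_smul]
    abel
  rw [h4, bracket, bracket, h2, sub_sub_sub_cancel_right, V.integrable]

/-- The form `ω` is closed for the new bracket: the correction is `-θ ∧ ω`. -/
theorem omega_bracket_cyclic (hA : V.g V.A V.A = 1) (x y z : 𝔤) :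
    -V.omega (V.bracket x y) z - V.omega (V.bracket y z) x - V.omega (V.bracket z x) y = 0 := by
  have h1 := V.lck x y z
  simp only [HermitianStructure.dOmega, HermitianStructure.omega] at h1
  simp only [HermitianStructure.omega, bracket, map_sub, map_smul, J_xi, LinearMap.sub_apply,
    LinearMap.smul_apply, map_neg, LinearMap.neg_apply, V.g_A, smul_eq_mul]
  rw [eta_lie hA, eta_lie hA, eta_lie hA, V.g_phi, V.g_phi, V.g_phi]
  linarith

/-- Removing the `ξ`-component of an operator killing `ξ` does not change its trace. -/
theorem trace_sub_smulRight_xi (T : 𝔤 →ₗ[ℝ] 𝔤) (hT : T V.xi = 0) :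
    LinearMap.trace ℝ 𝔤 (T - (V.eta ∘ₗ T).smulRight V.xi) = LinearMap.trace ℝ 𝔤 T := by
  rw [map_sub, LinearMap.trace_smulRight, LinearMap.comp_apply, hT, map_zero, sub_zero]

end Bracket

/-- The Lie algebra obtained from a Vaisman Lie algebra with central `ξ` by splitting `ξ` off: the
same vector space with the bracket `[x, y] - η([x, y]) ξ`. It is the direct sum of `𝔤 / ℝξ`
and the line `ℝξ`. -/
def Transverse (V : VaismanStructure 𝔤) (_ : ∀ x : 𝔤, ⁅V.xi, x⁆ = 0) : Type _ := 𝔤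

namespace Transverse

variable (V : VaismanStructure 𝔤) (hc : ∀ x : 𝔤, ⁅V.xi, x⁆ = 0)

instance : AddCommGroup (Transverse V hc) := inferInstanceAs (AddCommGroup 𝔤)

instance : Module ℝ (Transverse V hc) := inferInstanceAs (Module ℝ 𝔤)

instance : FiniteDimensional ℝ (Transverse V hc) := inferInstanceAs (FiniteDimensional ℝ 𝔤)

instance : Bracket (Transverse V hc) (Transverse V hc) := ⟨bracket (𝔤 := 𝔤) V⟩

instance : LieRing (Transverse V hc) where
  add_lie := bracket_add_left (𝔤 := 𝔤) (V := V)
  lie_add := bracket_add_right (𝔤 := 𝔤) (V := V)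
  lie_self := bracket_self (𝔤 := 𝔤) (V := V)
  leibniz_lie := bracket_leibniz (𝔤 := 𝔤) hc

instance : LieAlgebra ℝ (Transverse V hc) where
  lie_smul := bracket_smul_right (𝔤 := 𝔤) (V := V)

variable {V}

/-- The identity map to the underlying space. -/
def toBase : Transverse V hc →ₗ[ℝ] 𝔤 := (LinearMap.id : 𝔤 →ₗ[ℝ] 𝔤)

theorem isUnimodular (hu : IsUnimodular 𝔤) : IsUnimodular (Transverse V hc) := fun x =>
  (trace_sub_smulRight_xi (V := V) (LieAlgebra.ad ℝ 𝔤 (toBase hc x))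
    (by rw [LieAlgebra.ad_apply, ← lie_skew, hc, neg_zero])).trans (hu _)

/-- Solvability of `𝔤` passes to `Transverse V hc` in the form in which flatness requires it:
removing `ξ`-components changes neither the derived algebra's adjoint action nor traces. -/
theorem trace_ad_comp_ad_eq_zero [LieAlgebra.IsSolvable 𝔤] (x : Transverse V hc)
    (hx : x ∈ Submodule.span ℝ {m : Transverse V hc | ∃ y z : Transverse V hc, ⁅y, z⁆ = m}) :
    LinearMap.trace ℝ (Transverse V hc)
      (LieAlgebra.ad ℝ (Transverse V hc) x ∘ₗ LieAlgebra.ad ℝ (Transverse V hc) x) = 0 := by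
  set T := LieAlgebra.ad ℝ 𝔤 (toBase hc x) with hT
  have hTxi : T V.xi = 0 := by rw [hT, LieAlgebra.ad_apply, ← lie_skew, hc, neg_zero]
  have h1 : LieAlgebra.ad ℝ (Transverse V hc) x ∘ₗ LieAlgebra.ad ℝ (Transverse V hc) x
      = (T ∘ₗ T - (V.eta ∘ₗ (T ∘ₗ T)).smulRight V.xi : 𝔤 →ₗ[ℝ] 𝔤) := by
    refine LinearMap.ext fun z => ?_
    have h2 : V.bracket (toBase hc x) (V.bracket (toBase hc x) (toBase hc z))
        = (T ∘ₗ T - (V.eta ∘ₗ (T ∘ₗ T)).smulRight V.xi) (toBase hc z) := by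
      rw [bracket.eq_1 V (toBase hc x) (V.bracket _ _), lie_bracket hc]
      rfl
    exact h2
  -- `x` acts on `𝔤` as an element of the derived algebra of `𝔤`
  obtain ⟨y, hy, hyx⟩ : ∃ y ∈ Submodule.span ℝ {m : 𝔤 | ∃ y z : 𝔤, ⁅y, z⁆ = m},
      LieAlgebra.ad ℝ 𝔤 y = T := by
    have hS : Submodule.span ℝ {m : Transverse V hc | ∃ y z : Transverse V hc, ⁅y, z⁆ = m}
        ≤ ((Submodule.span ℝ {m : 𝔤 | ∃ y z : 𝔤, ⁅y, z⁆ = m}).map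
          (LieAlgebra.ad ℝ 𝔤 : 𝔤 →ₗ[ℝ] Module.End ℝ 𝔤)).comap
            ((LieAlgebra.ad ℝ 𝔤 : 𝔤 →ₗ[ℝ] Module.End ℝ 𝔤) ∘ₗ toBase hc) := by
      refine Submodule.span_le.2 ?_
      rintro _ ⟨a, b, rfl⟩
      refine ⟨⁅toBase hc a, toBase hc b⁆, Submodule.subset_span ⟨_, _, rfl⟩, ?_⟩
      exact LinearMap.ext fun z => (bracket_lie hc (toBase hc a) (toBase hc b) z).symm
    exact hS hx
  have h3 : LinearMap.trace ℝ 𝔤 (T ∘ₗ T - (V.eta ∘ₗ (T ∘ₗ T)).smulRight V.xi) = 0 := by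
    rw [trace_sub_smulRight_xi _ (by rw [LinearMap.comp_apply, hTxi, map_zero]), ← hyx]
    exact LieAlgebra.trace_ad_comp_ad_eq_zero_of_isSolvable hy
  rw [h1]
  exact h3

/-- The Kähler structure of `Transverse V hc`, given by the same inner product and complex
structure. -/
def hermitian (hA : V.g V.A V.A = 1) : HermitianStructure (Transverse V hc) where
  g := V.g
  J := V.J
  symm := V.symm
  pos := V.pos
  J_sq := V.J_sq
  J_skew := V.J_skew
  integrable := bracket_integrable (𝔤 := 𝔤) hA

theorem dOmega_eq_zero (hA : V.g V.A V.A = 1) (x y z : Transverse V hc) :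
    (hermitian hc hA).dOmega x y z = 0 :=
  omega_bracket_cyclic hA (toBase hc x) (toBase hc y) (toBase hc z)

/-- The Levi-Civita connection of `Transverse V hc`, on the underlying space. -/
def connection (hA : V.g V.A V.A = 1) : 𝔤 →ₗ[ℝ] 𝔤 →ₗ[ℝ] 𝔤 := (hermitian hc hA).leviCivita

variable (hA : V.g V.A V.A = 1)

theorem g_connection (x y z : 𝔤) : V.g (connection hc hA x y) z
    = (1 / 2 : ℝ) * (V.g (V.bracket x y) z - V.g (V.bracket y z) x + V.g (V.bracket z x) y) :=
  (hermitian hc hA).g_leviCivita x y z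

theorem connection_skew (x y z : 𝔤) :
    V.g (connection hc hA x y) z = -V.g y (connection hc hA x z) :=
  (hermitian hc hA).leviCivita_skew x y z

theorem connection_J (x y : 𝔤) : connection hc hA x (V.J y) = V.J (connection hc hA x y) :=
  (hermitian hc hA).leviCivita_J_of_dOmega_eq_zero (dOmega_eq_zero hc hA) x y

/-- The connection vanishes along `ξ`, as `ξ` is central and orthogonal to all new brackets. -/
theorem connection_xi (y : 𝔤) : connection hc hA V.xi y = 0 := by
  refine V.ext_g fun z => ?_
  have h1 (y : 𝔤) : V.bracket V.xi y = 0 := by simp [bracket, hc]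
  rw [g_connection, h1, bracket_swap z, h1, V.symm _ V.xi, V.g_xi, eta_bracket hA]
  simp

/-- The Lee vector stays parallel: it is Killing and orthogonal to all new brackets. -/
theorem connection_A (x : 𝔤) : connection hc hA x V.A = 0 := by
  refine V.ext_g fun z => ?_
  rw [g_connection, bracket_swap x, bracket_A hA, bracket_A hA, V.symm _ V.A, V.g_A,
    theta_bracket, map_neg, LinearMap.neg_apply, V.lie_A_skew x, V.symm x]
  simp

theorem theta_connection (x y : 𝔤) : V.θ (connection hc hA x y) = 0 := by
  rw [← V.g_A, V.symm, connection_skew, connection_A]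
  simp

theorem eta_connection (x y : 𝔤) : V.eta (connection hc hA x y) = 0 := by
  rw [← neg_eq_zero, ← V.theta_J, ← connection_J, theta_connection]

theorem connection_phi (x y : 𝔤) :
    connection hc hA x (V.phi y) = V.phi (connection hc hA x y) := by
  have h1 : connection hc hA x V.xi = 0 := by
    rw [xi, connection_J, connection_A, map_zero]
  rw [V.phi_apply, V.phi_apply, theta_connection, eta_connection, ← connection_J]
  simp [h1, connection_A]

/-- The Bismut connection of `V` differs from the Levi-Civita connection of
`Transverse V hc` only for derivatives along `ξ`. -/
theorem bismut_eq (x y : 𝔤) :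
    V.bismut x y = connection hc hA x y - V.eta x • V.phi y := by
  refine V.ext_g fun z => ?_
  rw [V.g_bismut, V.g_leviCivita, V.lck, map_sub, LinearMap.sub_apply, g_connection, map_smul,
    LinearMap.smul_apply]
  simp only [HermitianStructure.omega, V.theta_J, V.J_sq, bracket, map_sub, map_smul, map_neg,
    LinearMap.neg_apply, LinearMap.sub_apply, LinearMap.smul_apply, smul_eq_mul, V.g_xi,
    eta_lie hA, V.g_phi, V.J_skew]
  linarith

/-- Flatness of `connection`. The bracket is the original one, since `ξ`-directions do not
contribute. -/
theorem curvature_connection (u v w : 𝔤) [LieAlgebra.IsSolvable 𝔤] (hu : IsUnimodular 𝔤) :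
    connection hc hA u (connection hc hA v w) - connection hc hA v (connection hc hA u w)
      - connection hc hA ⁅u, v⁆ w = 0 := by
  have h1 := (hermitian hc hA).curvature_eq_zero_of_kaehler (isUnimodular hc hu)
    (trace_ad_comp_ad_eq_zero hc) (dOmega_eq_zero hc hA) u v
  have h2 : connection hc hA u (connection hc hA v w) - connection hc hA v (connection hc hA u w)
      - connection hc hA (V.bracket u v) w = 0 := LinearMap.congr_fun h1 w
  rw [bracket, map_sub, map_smul, LinearMap.sub_apply, LinearMap.smul_apply, connection_xi,
    smul_zero, sub_zero] at h2
  exact h2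

end Transverse

end VaismanStructure
end VaismanLie

end

theorem mainTheorem9 {𝔤 : Type*} [LieRing 𝔤] [LieAlgebra ℝ 𝔤] [FiniteDimensional ℝ 𝔤]
    (hsolv : LieAlgebra.IsSolvable 𝔤) (hunim : VaismanLie.IsUnimodular 𝔤)
    (V : VaismanLie.VaismanStructure 𝔤) (hA : V.g V.A V.A = 1) :
    (∀ u v : 𝔤, VaismanLie.curvature V.bismut u v = V.g (V.phi u) v • V.phi) ∧
    (∀ x y z w : 𝔤,
      VaismanLie.covDeriv V.bismut (VaismanLie.curvature V.bismut) x y z w = 0) := by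
  have hc := VaismanLie.VaismanStructure.lie_xi_eq_zero hunim hA
  set D := VaismanLie.VaismanStructure.Transverse.connection hc hA with hD
  have hb (x y : 𝔤) : V.bismut x y = D x y - V.eta x • V.phi y :=
    VaismanLie.VaismanStructure.Transverse.bismut_eq hc hA x y
  have hφ (x y : 𝔤) : D x (V.phi y) = V.phi (D x y) :=
    VaismanLie.VaismanStructure.Transverse.connection_phi hc hA x y
  have hbφ (x y : 𝔤) : V.bismut x (V.phi y) = V.phi (V.bismut x y) := by
    rw [hb, hb, hφ, map_sub, map_smul]
  have hbg (x y z : 𝔤) : V.g (V.bismut x y) z = -V.g y (V.bismut x z) := by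
    have h1 : V.g (D x y) z = -V.g y (D x z) :=
      VaismanLie.VaismanStructure.Transverse.connection_skew hc hA x y z
    rw [hb, hb, map_sub, map_sub, map_smul, map_smul, LinearMap.sub_apply, LinearMap.smul_apply,
      h1, V.phi_skew, smul_neg]
    ring
  have hR (u v : 𝔤) : VaismanLie.curvature V.bismut u v = V.g (V.phi u) v • V.phi := by
    ext w
    have h1 := VaismanLie.VaismanStructure.Transverse.curvature_connection hc hA u v w hunim
    rw [← hD] at h1
    simp only [VaismanLie.curvature, LinearMap.sub_apply, LinearMap.comp_apply,
      LinearMap.smul_apply, hb, map_sub, map_smul, hφ]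
    rw [VaismanLie.VaismanStructure.eta_lie hA, sub_eq_zero.1 h1 |>.symm]
    module
  refine ⟨hR, fun x y z w => ?_⟩
  simp only [VaismanLie.covDeriv, hR, LinearMap.smul_apply, map_smul, hbφ]
  rw [← hbφ x y, hbg]
  module
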